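/- For a metrizable space $Z$ and $z\in Z$, let $\pi_1(Z,z)$ denote the topological fundamental group: the set of path components of the space of loops $f:[0,1]\to Z$, $f(0)=f(1)=z$ (with the topology of uniform convergence), with the quotient topology. A metric space $X$ is similar to the Hawaiian earring, with distinguished point $p\in X$, if $X=\bigcup_{n=1}^\infty Y_n$, where $Y_n\cap Y_m=\{p\}$ whenever $n\neq m$, each $Y_n$ is closed in $X$, path connected, locally simply connected at $p$ (that is, $p$ has arbitrarily small simply connected neighbourhoods in $Y_n$) and not simply connected, and $\lim_{n\to\infty}\operatorname{diam}(Y_n)=0$. Theorem. Let $X$ be similar to the Hawaiian earring, with distinguished point $p$, let $Y$ be a metrizable space and let $y_0\in Y$ be such that $\pi_1(Y,y_0)$ is completely metrizable (that is, its topology is induced by a complete metric). Then $X$ cannot be embedded as a retract of $Y$ (within the path component of $y_0$): there is no topological embedding $e:X\to Y$ such that $e(p)$ lies in the path component of $y_0$ (for instance $e(p)=y_0$) and $e(X)$ is a retract of $Y$, i.e. such that some continuous map $r:Y\to e(X)$ restricts to the identity on $e(X)$. -/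

import Mathlib

open Topology

/-- The topological fundamental group of `X` at `p`, as a space: the set of path components of the
space `Path p p` of loops at `p`, with the quotient topology. Mathlib's topology on `Path p p` is
the compact-open topology, which for metrizable `X` is that of uniform convergence. -/
def TopFundamentalGroup (X : Type*) [TopologicalSpace X] (p : X) : Type _ :=
  ZerothHomotopy (Path p p)

instance TopFundamentalGroup.instTopologicalSpace (X : Type*) [TopologicalSpace X] (p : X) :
    TopologicalSpace (TopFundamentalGroup X p) :=
  inferInstanceAs (TopologicalSpace (Quotient (pathSetoid (Path p p))))

/-- The subspace `A` of `Y` is a retract of `Y`: some continuous map `Y → A` restricts to the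
identity of `A`. -/
def IsRetract {Y : Type*} [TopologicalSpace Y] (A : Set Y) : Prop :=
  ∃ r : C(Y, A), ∀ a : A, r a = a

/-- `Z` is locally simply connected at `z`: the point `z` has arbitrarily small simply connected
neighbourhoods (not required to be open). -/
def LocallySimplyConnectedAt {Z : Type*} [TopologicalSpace Z] (z : Z) : Prop :=
  ∀ U ∈ 𝓝 z, ∃ V ∈ 𝓝 z, V ⊆ U ∧ IsSimplyConnected V

/-- The metric space `X` is similar to the Hawaiian earring, with distinguished point `p`, the
pieces being the sets `Y n`. The diameter is the extended one, so that finitely many pieces may be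
unbounded. -/
structure IsHawaiianDecomposition {X : Type*} [MetricSpace X] (p : X) (Y : ℕ → Set X) : Prop where
  iUnion_eq : ⋃ n, Y n = Set.univ
  inter_eq : ∀ n m, n ≠ m → Y n ∩ Y m = {p}
  isClosed : ∀ n, IsClosed (Y n)
  isPathConnected : ∀ n, IsPathConnected (Y n)
  locallySimplyConnectedAt : ∀ n (hp : p ∈ Y n), LocallySimplyConnectedAt (⟨p, hp⟩ : Y n)
  not_isSimplyConnected : ∀ n, ¬ IsSimplyConnected (Y n)
  tendsto_diam : Filter.Tendsto (fun n => Metric.ediam (Y n)) Filter.atTop (𝓝 0)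

/-- `X` is similar to the Hawaiian earring, with distinguished point `p`. -/
def IsSimilarToHawaiianEarring (X : Type*) [MetricSpace X] (p : X) : Prop :=
  ∃ Y : ℕ → Set X, IsHawaiianDecomposition p Y

/-! A retraction `Y → e(X)`, with a change of base point, makes the fundamental group of `X` a
subspace of that of `Y`, so it suffices that the former is not metrizable. Choose an essential loop
`x n` in each piece; these tend to the constant loop. For fixed `k`, the classes of `[x 0, x n] ^ k`
tend to the trivial class as `n → ∞`. If the quotient were metrizable, a countable base at the
trivial class would give a diagonal sequence `c k = [x 0, x (n k)] ^ (k + 1)` converging to it. The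
contradiction is that the classes of the `c k` form a closed set missing the trivial class.
Closedness is tested in the loop space by word length. Collapsing `X` onto the pieces `0` and `n`
lets a loop spell a homotopy-invariant element of a free product of two groups, in which `c k` has
length at least `k + 1` (`le_length_spell_commPow`). Near any loop these lengths are bounded
uniformly in `n` (`exists_eventually_length_spell_le`), so the classes `c k`, seen as sets of loops,
form a locally finite family. The spelling avoids van Kampen: it is the integral along the loop of a
group-valued local cocycle. -/

/-! ### Integration of non-commutative local cocycles -/

section Cocycle

variable {Z Z' G : Type*} [TopologicalSpace Z] [TopologicalSpace Z'] [Group G]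

/-- A function of two points is a local cocycle if it is multiplicative near each point. -/
def IsLocalCocycle (d : Z → Z → G) : Prop :=
  ∀ z, ∃ N ∈ 𝓝 z, ∀ u ∈ N, ∀ v ∈ N, ∀ w ∈ N, d v w * d u v = d u w

/-- `θ` is a primitive of `d` if the increments of `θ` are locally given by `d`. -/
def IsPrimitive (d : Z → Z → G) (θ : Z → G) : Prop :=
  ∀ z, ∃ N ∈ 𝓝 z, ∀ u ∈ N, ∀ v ∈ N, θ v = d u v * θ u

theorem IsPreconnected.eq_of_locally_eq {α : Type*} {K : Set Z} (hK : IsPreconnected K) {η : Z → α}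
    (h : ∀ x ∈ K, ∃ N ∈ 𝓝 x, ∀ y ∈ N ∩ K, η y = η x) {x y : Z} (hx : x ∈ K) (hy : y ∈ K) :
    η x = η y := by
  let _ : TopologicalSpace α := ⊥
  have : DiscreteTopology α := ⟨rfl⟩
  refine hK.constant (f := η) ?_ hx hy
  intro z hz
  obtain ⟨N, hN, h⟩ := h z hz
  refine tendsto_nhds_of_eventually_eq ?_
  filter_upwards [mem_nhdsWithin_of_mem_nhds hN, self_mem_nhdsWithin] with y h1 h2
  exact h y ⟨h1, h2⟩

/-- The quotient `(d u v)⁻¹ * θ v` is locally constant in `v` along `K`. This turns the local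
increments of a primitive into one increment over a whole subinterval. -/
theorem IsPrimitive.eq_mul_of_isPreconnected {d : Z → Z → G} {θ : Z → G} (hθ : IsPrimitive d θ)
    {K : Set Z} (hK : IsPreconnected K)
    (hd : ∀ u ∈ K, ∀ v ∈ K, ∀ w ∈ K, d v w * d u v = d u w) {u v : Z} (hu : u ∈ K) (hv : v ∈ K) :
    θ v = d u v * θ u := by
  have key := hK.eq_of_locally_eq (η := fun v => (d u v)⁻¹ * θ v) (fun x hx => by
    obtain ⟨N, hN, h⟩ := hθ x
    refine ⟨N, hN, fun y hy => ?_⟩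
    rw [h x (mem_of_mem_nhds hN) y hy.1, ← hd u hu x hx y hy.2]
    group) hu hv
  have h1 : d u u = 1 := by simpa using hd u hu u hu u hu
  simp only [h1, inv_one, one_mul] at key
  rw [key]; group

theorem IsPrimitive.eq_of_eq [PreconnectedSpace Z] {d : Z → Z → G} {θ θ' : Z → G}
    (hθ : IsPrimitive d θ) (hθ' : IsPrimitive d θ') {z : Z} (hz : θ z = θ' z) (y : Z) :
    θ y = θ' y := by
  have key := isPreconnected_univ.eq_of_locally_eq (η := fun v => (θ v)⁻¹ * θ' v) (fun x _ => by
    obtain ⟨N, hN, h⟩ := hθ x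
    obtain ⟨N', hN', h'⟩ := hθ' x
    refine ⟨N ∩ N', Filter.inter_mem hN hN', fun y hy => ?_⟩
    rw [h x (mem_of_mem_nhds hN) y hy.1.1, h' x (mem_of_mem_nhds hN') y hy.1.2]
    group) (Set.mem_univ z) (Set.mem_univ y)
  simp only [hz, inv_mul_cancel] at key
  exact (eq_of_inv_mul_eq_one key.symm)

theorem IsPrimitive.comp {d : Z → Z → G} {θ : Z → G} (hθ : IsPrimitive d θ) {h : Z' → Z}
    (hh : Continuous h) : IsPrimitive (fun u v => d (h u) (h v)) (θ ∘ h) := by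
  intro z
  obtain ⟨N, hN, H⟩ := hθ (h z)
  exact ⟨h ⁻¹' N, hh.continuousAt hN, fun u hu v hv => H _ hu _ hv⟩

theorem IsLocalCocycle.comp {d : Z → Z → G} (hd : IsLocalCocycle d) {h : Z' → Z}
    (hh : Continuous h) : IsLocalCocycle (fun u v => d (h u) (h v)) := by
  intro z
  obtain ⟨N, hN, H⟩ := hd (h z)
  exact ⟨h ⁻¹' N, hh.continuousAt hN, fun u hu v hv w hw => H _ hu _ hv _ hw⟩

theorem IsPrimitive.mul_right {d : Z → Z → G} {θ : Z → G} (hθ : IsPrimitive d θ) (g : G) :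
    IsPrimitive d (fun z => θ z * g) := by
  intro z
  obtain ⟨N, hN, H⟩ := hθ z
  exact ⟨N, hN, fun u hu v hv => by simp only [H u hu v hv, mul_assoc]⟩

/-- Subdivide the interval so finely that `d` is multiplicative on each part, and continue the
primitive across one part at a time. -/
theorem IsLocalCocycle.exists_isPrimitive {d : unitInterval → unitInterval → G}
    (hd : IsLocalCocycle d) : ∃ θ, IsPrimitive d θ ∧ θ 0 = 1 := by
  choose N hN hd using hd
  obtain ⟨t, ht0, htm, ⟨n, hn⟩, htc⟩ := exists_monotone_Icc_subset_open_cover_unitInterval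
    (c := fun z => interior (N z)) (fun z => isOpen_interior)
    (fun z _ => Set.mem_iUnion.2 ⟨z, mem_interior_iff_mem_nhds.2 (hN z)⟩)
  have hd1 : ∀ z u, u ∈ N z → d u u = 1 := fun z u hu => by simpa using hd z u hu u hu u hu
  have key : ∀ m, ∃ θ : unitInterval → G, θ 0 = 1 ∧ ∀ z ≤ t m, ∃ W ∈ 𝓝 z,
      ∀ u ∈ W, ∀ v ∈ W, u ≤ t m → v ≤ t m → θ v = d u v * θ u := by
    intro m
    induction m with
    | zero =>
      refine ⟨fun _ => 1, rfl, fun z hz => ⟨N z, hN z, fun u hu v hv hu0 hv0 => ?_⟩⟩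
      rw [ht0] at hu0 hv0
      obtain rfl : u = 0 := le_antisymm hu0 bot_le
      obtain rfl : v = 0 := le_antisymm hv0 bot_le
      simp [hd1 z 0 hu]
    | succ m ih =>
      obtain ⟨θ, hθ0, hθ⟩ := ih
      obtain ⟨y, hy⟩ := htc m
      have hmm : t m ≤ t (m + 1) := htm (Nat.le_succ m)
      have htmN : t m ∈ N y := interior_subset (hy ⟨le_rfl, hmm⟩)
      classical
      refine ⟨fun s => if s ≤ t m then θ s else d (t m) s * θ (t m), ?_, fun z hz => ?_⟩
      · simp [hθ0, show (0 : unitInterval) ≤ t m from bot_le]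
      rcases lt_trichotomy z (t m) with h | h | h
      · obtain ⟨W, hW, H⟩ := hθ z h.le
        refine ⟨W ∩ Set.Iio (t m), Filter.inter_mem hW (Iio_mem_nhds h), fun u hu v hv _ _ => ?_⟩
        have h1 : u ≤ t m := le_of_lt hu.2
        have h2 : v ≤ t m := le_of_lt hv.2
        simpa [h1, h2] using H u hu.1 v hv.1 h1 h2
      · subst h
        obtain ⟨W, hW, H⟩ := hθ (t m) le_rfl
        have htW : t m ∈ W := mem_of_mem_nhds hW
        refine ⟨W ∩ N y, Filter.inter_mem hW (mem_interior_iff_mem_nhds.1 (hy ⟨le_rfl, hmm⟩)),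
          fun u hu v hv hu1 hv1 => ?_⟩
        by_cases hum : u ≤ t m <;> by_cases hvm : v ≤ t m <;> simp only [hum, hvm, if_true, if_false]
        · exact H u hu.1 v hv.1 hum hvm
        · rw [H u hu.1 _ htW hum le_rfl, ← mul_assoc, hd y _ hu.2 _ htmN _ hv.2]
        · rw [H _ htW v hv.1 le_rfl hvm, ← mul_assoc, hd y _ htmN _ hu.2 _ hv.2]
        · rw [← mul_assoc, hd y _ htmN _ hu.2 _ hv.2]
      · refine ⟨Set.Ioi (t m) ∩ N y, Filter.inter_mem (Ioi_mem_nhds h)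
          (mem_interior_iff_mem_nhds.1 (hy ⟨h.le, hz⟩)), fun u hu v hv hu1 hv1 => ?_⟩
        have h1 : ¬ u ≤ t m := not_le.2 hu.1
        have h2 : ¬ v ≤ t m := not_le.2 hv.1
        simp only [h1, h2, if_false]
        rw [← mul_assoc, hd y _ htmN _ hu.2 _ hv.2]
  obtain ⟨θ, h0, h⟩ := key n
  refine ⟨θ, fun z => ?_, h0⟩
  have h1 : ∀ u, u ≤ t n := fun u => by rw [hn n le_rfl]; exact le_top
  obtain ⟨W, hW, H⟩ := h z (h1 z)
  exact ⟨W, hW, fun u hu v hv => H u hu v hv (h1 u) (h1 v)⟩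

/-- The value at `1` of the primitive of `d` which is `1` at `0`. -/
noncomputable def IsLocalCocycle.integral {d : unitInterval → unitInterval → G}
    (hd : IsLocalCocycle d) : G := hd.exists_isPrimitive.choose 1

theorem IsPrimitive.apply_one {d : unitInterval → unitInterval → G} {θ : unitInterval → G}
    (hθ : IsPrimitive d θ) (hd : IsLocalCocycle d) : θ 1 = hd.integral * θ 0 := by
  have h := hd.exists_isPrimitive.choose_spec
  exact hθ.eq_of_eq (h.1.mul_right (θ 0)) (z := 0) (by rw [h.2, one_mul]) 1

/-- The integral over `{s} × [0,1]` is locally constant in `s`: a primitive on one such segment is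
carried to a nearby one by multiplying with `d` across the gap, and this correction is trivial at
both ends. -/
theorem IsLocalCocycle.integral_eq_of_homotopy
    {d : unitInterval × unitInterval → unitInterval × unitInterval → G} (hd : IsLocalCocycle d)
    (h0 : ∀ s s', d (s, 0) (s', 0) = 1) (h1 : ∀ s s', d (s, 1) (s', 1) = 1)
    (s s' : unitInterval) :
    (hd.comp (h := fun t : unitInterval => (s, t)) (by fun_prop)).integral =
      (hd.comp (h := fun t : unitInterval => (s', t)) (by fun_prop)).integral := by
  refine isPreconnected_univ.eq_of_locally_eq
    (η := fun s => (hd.comp (h := fun t : unitInterval => (s, t)) (by fun_prop)).integral)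
    (fun x _ => ?_) (Set.mem_univ s) (Set.mem_univ s')
  have hx := (hd.comp (h := fun t : unitInterval => (x, t)) (by fun_prop))
  obtain ⟨θ, hθ, hθ0⟩ := hx.exists_isPrimitive
  -- By compactness, one neighbourhood of `x` serves all `t`; the cocycle identity is needed for
  -- every mixture of the two segments over `x` and `s`.
  have hloc : ∀ᶠ s in 𝓝 x, ∀ t ∈ (Set.univ : Set unitInterval), ∃ W ∈ 𝓝 t,
      (∀ u ∈ W, ∀ v ∈ W, θ v = d (x, u) (x, v) * θ u) ∧
      ∀ a ∈ W, ∀ b ∈ W, ∀ c ∈ W, ∀ i ∈ ({x, s} : Set unitInterval), ∀ j ∈ ({x, s} : Set unitInterval),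
        ∀ k ∈ ({x, s} : Set unitInterval), d (j, b) (k, c) * d (i, a) (j, b) = d (i, a) (k, c) := by
    refine isCompact_univ.eventually_forall_of_forall_eventually fun t _ => ?_
    obtain ⟨W, hW, H⟩ := hθ t
    obtain ⟨N, hN, hdN⟩ := hd (x, t)
    rw [nhds_prod_eq, Filter.mem_prod_iff] at hN
    obtain ⟨A, hA, B, hB, hAB⟩ := hN
    rw [nhds_prod_eq, Filter.eventually_iff, Filter.mem_prod_iff]
    refine ⟨A, hA, interior (W ∩ B), interior_mem_nhds.2 (Filter.inter_mem hW hB), ?_⟩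
    rintro ⟨s, t'⟩ ⟨hs, ht'⟩
    refine ⟨W ∩ B, mem_interior_iff_mem_nhds.1 ht', fun u hu v hv => H u hu.1 v hv.1, ?_⟩
    have hA' : ∀ i ∈ ({x, s} : Set unitInterval), i ∈ A := by
      rintro i (rfl | rfl)
      · exact mem_of_mem_nhds hA
      · exact hs
    intro a ha b hb c hc i hi j hj k hk
    exact hdN _ (hAB ⟨hA' i hi, ha.2⟩) _ (hAB ⟨hA' j hj, hb.2⟩) _ (hAB ⟨hA' k hk, hc.2⟩)
  obtain ⟨N, hN, hloc⟩ := Filter.eventually_iff_exists_mem.1 hloc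
  refine ⟨N, hN, fun s hs => ?_⟩
  have hθs : IsPrimitive (fun u v => d (s, u) (s, v)) (fun t => d (x, t) (s, t) * θ t) := by
    intro t
    obtain ⟨W, hW, H, hdW⟩ := hloc s hs.1 t trivial
    refine ⟨W, hW, fun u hu v hv => ?_⟩
    simp only
    rw [H u hu v hv, ← mul_assoc, ← mul_assoc, hdW u hu v hv v hv x (by simp) x (by simp) s (by simp),
      hdW u hu u hu v hv x (by simp) s (by simp) s (by simp)]
  have e1 := hθs.apply_one (hd.comp (h := fun t : unitInterval => (s, t)) (by fun_prop))
  have e2 := hθ.apply_one hx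
  simp only [h0, h1, hθ0, one_mul, mul_one] at e1 e2
  exact e1.symm.trans e2

end Cocycle

/-! ### Cocycles of path classes -/

instance unitInterval.contractibleSpace : ContractibleSpace unitInterval :=
  (convex_Icc (0 : ℝ) 1).contractibleSpace ⟨0, by simp⟩

instance unitInterval.locallyPathConnectedSpace : LocallyPathConnectedSpace unitInterval :=
  (convex_Icc (0 : ℝ) 1).locallyPathConnectedSpace

namespace Path.Homotopic.Quotient

variable {X Y : Type*} [TopologicalSpace X] [TopologicalSpace Y] {x y z : X}

theorem map_trans (f : Path.Homotopic.Quotient x y) (g : Path.Homotopic.Quotient y z) (F : C(X, Y)) :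
    (f.trans g).map F = (f.map F).trans (g.map F) := by
  induction f, g using Path.Homotopic.Quotient.ind₂ with
  | _ f g => rw [← mk_trans, ← mk_map, ← mk_map, ← mk_map, ← mk_trans, Path.map_trans]

theorem trans_symm_trans (f : Path.Homotopic.Quotient y x) (g : Path.Homotopic.Quotient x z) :
    f.symm.trans (f.trans g) = g := by
  rw [← trans_assoc, symm_trans, refl_trans]

end Path.Homotopic.Quotient

section PathCocycle

open Path.Homotopic.Quotient

variable {X Z Z' : Type*} [TopologicalSpace X] [TopologicalSpace Z] [TopologicalSpace Z'] {p : X}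

/-- The class of the image under `F` of a path from `u` to `v`, made into a loop at `p` by means of
the path classes `γ`. -/
noncomputable def pathCocycle [PathConnectedSpace Z]
    (γ : ∀ x : X, Path.Homotopic.Quotient p x) (F : C(Z, X)) (u v : Z) : FundamentalGroup X p :=
  (γ (F u)).trans ((map (mk (PathConnectedSpace.somePath u v)) F).trans (γ (F v)).symm)

variable (γ : ∀ x : X, Path.Homotopic.Quotient p x)

theorem pathCocycle_eq [SimplyConnectedSpace Z] (F : C(Z, X)) {u v : Z}
    (f : Path.Homotopic.Quotient u v) :
    pathCocycle γ F u v = (γ (F u)).trans ((f.map F).trans (γ (F v)).symm) := by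
  rw [pathCocycle, Subsingleton.elim (mk (PathConnectedSpace.somePath u v)) f]

theorem pathCocycle_mul [SimplyConnectedSpace Z] (F : C(Z, X)) (u v w : Z) :
    pathCocycle γ F v w * pathCocycle γ F u v = pathCocycle γ F u w := by
  let f := mk (PathConnectedSpace.somePath u v)
  let g := mk (PathConnectedSpace.somePath v w)
  rw [pathCocycle_eq γ F f, pathCocycle_eq γ F g, pathCocycle_eq γ F (f.trans g), map_trans]
  refine FundamentalGroup.mul_def.trans ?_
  simp only [trans_assoc, trans_symm_trans]

theorem pathCocycle_comp [SimplyConnectedSpace Z] [SimplyConnectedSpace Z'] (F : C(Z, X))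
    (h : C(Z', Z)) (u v : Z') :
    pathCocycle γ (F.comp h) u v = pathCocycle γ F (h u) (h v) := by
  let f := mk (PathConnectedSpace.somePath u v)
  rw [pathCocycle_eq γ (F.comp h) f, pathCocycle_eq γ F (f.map h), ← map_comp]
  rfl

/-- The path classes `γ` are compatible with the paths inside `V`. -/
def IsCompatibleOn (V : Set X) : Prop :=
  ∀ x y (f : Path x y), (∀ t, f t ∈ V) → (γ x).trans (mk f) = γ y

variable {γ}

theorem IsCompatibleOn.pathCocycle_eq_one [SimplyConnectedSpace Z] {V : Set X}
    (hγ : IsCompatibleOn γ V) {F : C(Z, X)} {S : Set Z} (hS : IsPathConnected S)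
    (hF : ∀ z ∈ S, F z ∈ V) {u v : Z} (hu : u ∈ S) (hv : v ∈ S) : pathCocycle γ F u v = 1 := by
  obtain ⟨f, hf⟩ := hS.joinedIn u hu v hv
  rw [pathCocycle_eq γ F (mk f), ← trans_assoc, ← mk_map,
    hγ _ _ (f.map F.continuous) fun t => hF _ (hf t), trans_symm]
  rfl

/-- The cocycle between the endpoints is the class of `f` conjugated by `γ p`, which need not be
trivial itself. -/
theorem homotopic_refl_of_pathCocycle_eq_one {f : Path p p}
    (h : pathCocycle γ f.toContinuousMap 0 1 = 1) : f.Homotopic (Path.refl p) := by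
  -- The endpoints `f 0` and `f 1` equal `p` only propositionally, so the cancellation is done for
  -- free endpoints and then cast.
  have key : ∀ {a b : X} (hab : a = b) (g : Path.Homotopic.Quotient a b),
      (γ a).trans (g.trans (γ b).symm) = Path.Homotopic.Quotient.refl p →
      g = (Path.Homotopic.Quotient.refl a).cast rfl hab.symm := by
    rintro a _ rfl g h
    have := congrArg (fun k => (γ a).symm.trans (k.trans (γ a))) h
    simpa [trans_assoc, trans_symm_trans] using this
  rw [pathCocycle_eq γ _ (mk Path.id)] at h
  have h1 := key (by simp) _ h
  rw [← Path.Homotopic.Quotient.eq, mk_refl]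
  have h2 : f = (Path.id.map f.toContinuousMap.continuous).cast f.source.symm f.target.symm := by
    ext t; rfl
  have h3 : mk f = (map (mk Path.id) f.toContinuousMap).cast f.source.symm f.target.symm := by
    rw [← mk_map, ← mk_cast, ← h2]
  rw [h3, h1, Path.Homotopic.Quotient.cast_cast]
  have : ∀ {a : X} (h h' : p = a), (Path.Homotopic.Quotient.refl a).cast h h' =
    Path.Homotopic.Quotient.refl p := by rintro a rfl _; simp
  exact this _ _

end PathCocycle

/-! ### The word spelled by a loop -/

/-- The free product of two copies of a group. -/
abbrev FreeSquare (G : Type*) [Group G] : Type _ := Monoid.CoprodI (fun _ : Bool => G)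

/-- The inclusion of a copy of `G` into the free product of two copies. -/
abbrev letter {G : Type*} [Group G] (b : Bool) : G →* FreeSquare G :=
  Monoid.CoprodI.of (M := fun _ : Bool => G) (i := b)

/-- Two self-maps `q b` of a space fixing `p`, and sets `V b` whose paths are determined up to homotopy
by their endpoints, such that near each point one of the maps takes its values in its set. -/
structure CollapsePair {X : Type*} [TopologicalSpace X] (p : X) where
  q : Bool → C(X, X)
  q_base : ∀ b, q b p = p
  V : Bool → Set X
  mem_V : ∀ b, p ∈ V b
  γ : Bool → ∀ x : X, Path.Homotopic.Quotient p x
  compatible : ∀ b, IsCompatibleOn (γ b) (V b)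
  cover : ∀ x, ∃ b, q b ⁻¹' V b ∈ 𝓝 x

namespace CollapsePair

variable {X Z Z' : Type*} [TopologicalSpace X] [TopologicalSpace Z] [TopologicalSpace Z'] {p : X}
  [SimplyConnectedSpace Z] [SimplyConnectedSpace Z'] (W : CollapsePair p)

/-- The product in the free product of the two cocycles of the pair. -/
noncomputable def cocycle (F : C(Z, X)) (u v : Z) :
    FreeSquare (FundamentalGroup X p) :=
  letter false (pathCocycle (W.γ false) ((W.q false).comp F) u v) *
    letter true (pathCocycle (W.γ true) ((W.q true).comp F) u v)

theorem cocycle_comp (F : C(Z, X)) (h : C(Z', Z)) (u v : Z') :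
    W.cocycle (F.comp h) u v = W.cocycle F (h u) (h v) := by
  have h1 := fun b => pathCocycle_comp (W.γ b) ((W.q b).comp F) h u v
  rw [cocycle, cocycle, ← h1, ← h1]
  rfl

/-- A product of two cocycles in a non-commutative group is not in general a cocycle. Where one
collapse stays in its set `V b`, that factor is `1` and a single letter remains, so multiplicativity
survives. -/
theorem cocycle_eq_of {F : C(Z, X)} {S : Set Z} (hS : IsPathConnected S) {b : Bool}
    (hF : ∀ z ∈ S, W.q b (F z) ∈ W.V b) {u v : Z} (hu : u ∈ S) (hv : v ∈ S) :
    W.cocycle F u v = letter (!b) (pathCocycle (W.γ !b) ((W.q !b).comp F) u v) := by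
  have := (W.compatible b).pathCocycle_eq_one (F := (W.q b).comp F) hS hF hu hv
  cases b
  · rw [cocycle, this, map_one, one_mul]; rfl
  · rw [cocycle, this, map_one, mul_one]; rfl

theorem cocycle_mul_of {F : C(Z, X)} {S : Set Z} (hS : IsPathConnected S) {b : Bool}
    (hF : ∀ z ∈ S, W.q b (F z) ∈ W.V b) {u v w : Z} (hu : u ∈ S) (hv : v ∈ S) (hw : w ∈ S) :
    W.cocycle F v w * W.cocycle F u v = W.cocycle F u w := by
  rw [W.cocycle_eq_of hS hF hu hv, W.cocycle_eq_of hS hF hv hw, W.cocycle_eq_of hS hF hu hw,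
    ← map_mul, pathCocycle_mul]

theorem isLocalCocycle [LocallyPathConnectedSpace Z] (F : C(Z, X)) :
    IsLocalCocycle (W.cocycle F) := by
  intro z
  obtain ⟨b, hb⟩ := W.cover (F z)
  obtain ⟨S, ⟨hSz, hS⟩, hSF⟩ := (LocallyPathConnectedSpace.path_connected_basis z).mem_iff.1
    (F.continuous.continuousAt hb)
  exact ⟨S, hSz, fun u hu v hv w hw => W.cocycle_mul_of hS (fun z hz => hSF hz) hu hv hw⟩

theorem cocycle_eq_one {F : C(Z, X)} {S : Set Z} (hS : IsPathConnected S)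
    (hF : ∀ z ∈ S, F z = p) {u v : Z} (hu : u ∈ S) (hv : v ∈ S) : W.cocycle F u v = 1 := by
  rw [W.cocycle_eq_of hS (b := true) (fun z hz => by rw [hF z hz, W.q_base]; exact W.mem_V _) hu hv,
    (W.compatible _).pathCocycle_eq_one (F := (W.q _).comp F) hS (fun z hz => by
      rw [ContinuousMap.comp_apply, hF z hz, W.q_base]; exact W.mem_V _) hu hv, map_one]

/-- The element of the free product spelled by a loop. -/
noncomputable def spell (f : Path p p) : FreeSquare (FundamentalGroup X p) :=
  (W.isLocalCocycle f.toContinuousMap).integral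

/-- The homotopy pulls the cocycle back to the square, where it is trivial along the two sides
mapped to `p`. -/
theorem spell_eq_of_homotopic {f g : Path p p} (h : f.Homotopic g) : W.spell f = W.spell g := by
  obtain ⟨H⟩ := h
  have hc : ∀ c : unitInterval, IsPathConnected (Set.range fun s : unitInterval => (s, c)) :=
    fun c => isPathConnected_range (by fun_prop)
  have key := (W.isLocalCocycle (H : C(unitInterval × unitInterval, X))).integral_eq_of_homotopy
    (fun s s' => W.cocycle_eq_one (hc 0) (by rintro _ ⟨s, rfl⟩; exact H.source s) ⟨s, rfl⟩ ⟨s', rfl⟩)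
    (fun s s' => W.cocycle_eq_one (hc 1) (by rintro _ ⟨s, rfl⟩; exact H.target s) ⟨s, rfl⟩ ⟨s', rfl⟩)
    0 1
  have aux : ∀ (s : unitInterval) (f : Path p p), (∀ t, H (s, t) = f t) →
      W.spell f = ((W.isLocalCocycle (H : C(unitInterval × unitInterval, X))).comp
        (h := fun t : unitInterval => (s, t)) (by fun_prop)).integral := by
    intro s f hf
    have e : f.toContinuousMap = (H : C(unitInterval × unitInterval, X)).comp
        ⟨fun t : unitInterval => (s, t), by fun_prop⟩ := by
      ext t; exact (hf t).symm
    rw [spell]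
    congr 1
    funext u v
    rw [e, cocycle_comp]
    rfl
  rw [aux 0 f (fun t => by simp), aux 1 g (fun t => by simp), key]

theorem spell_refl : W.spell (Path.refl p) = 1 := by
  have h : IsPrimitive (W.cocycle (Path.refl p).toContinuousMap) (fun _ => 1) := fun z =>
    ⟨Set.univ, Filter.univ_mem, fun u _ v _ => by
      rw [W.cocycle_eq_one isPathConnected_univ (fun z _ => rfl) (Set.mem_univ _) (Set.mem_univ _),
        one_mul]⟩
  have := h.apply_one (W.isLocalCocycle _)
  rw [mul_one] at this
  exact this.symm

theorem apply_one_of_isPrimitive {F : C(unitInterval, X)}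
    {θ : unitInterval → FreeSquare (FundamentalGroup X p)}
    (hθ : IsPrimitive (W.cocycle F) θ) {h : C(unitInterval, unitInterval)} {f : Path p p}
    (hf : ∀ t, F (h t) = f t) : θ (h 1) = W.spell f * θ (h 0) := by
  have e : f.toContinuousMap = F.comp h := by ext t; exact (hf t).symm
  have h1 : IsPrimitive (W.cocycle f.toContinuousMap) (θ ∘ h) := by
    have := hθ.comp h.continuous
    simp only [← cocycle_comp] at this
    rwa [e]
  exact h1.apply_one (W.isLocalCocycle _)

/-- The order is reversed because increments accumulate on the left. Both halves are integrated with
one primitive for the concatenation. -/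
theorem spell_trans (f g : Path p p) : W.spell (f.trans g) = W.spell g * W.spell f := by
  obtain ⟨θ, hθ, hθ0⟩ := (W.isLocalCocycle (f.trans g).toContinuousMap).exists_isPrimitive
  let h : C(unitInterval, unitInterval) := ⟨fun t => ⟨(t : ℝ) / 2, by
    constructor <;> linarith [t.2.1, t.2.2]⟩, by fun_prop⟩
  let k : C(unitInterval, unitInterval) := ⟨fun t => ⟨((t : ℝ) + 1) / 2, by
    constructor <;> linarith [t.2.1, t.2.2]⟩, by fun_prop⟩
  have e1 := W.apply_one_of_isPrimitive hθ (h := h) (f := f) (fun t => by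
    change (f.trans g) _ = _
    have : (h t : ℝ) ≤ 1 / 2 := by
      change (t : ℝ) / 2 ≤ 1 / 2
      linarith [t.2.2]
    rw [Path.trans_apply, dif_pos this]
    congr 1; ext; simp [h]; ring)
  have e2 := W.apply_one_of_isPrimitive hθ (h := k) (f := g) (fun t => by
    change (f.trans g) _ = _
    rw [Path.trans_apply]
    split_ifs with ht
    · have : (t : ℝ) = 0 := by
        have h1 : ((t : ℝ) + 1) / 2 ≤ 1 / 2 := ht
        linarith [t.2.1]
      have h0 : t = 0 := Subtype.ext this
      subst h0
      rw [g.source]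
      convert f.target using 2
      ext; simp [k]
    · congr 1; ext; simp [k]; ring)
  have e3 := hθ.apply_one (W.isLocalCocycle _)
  have h0 : h 0 = 0 := by ext; simp [h]
  have h1 : h 1 = k 0 := by ext; simp [h, k]
  have k1 : k 1 = 1 := by ext; simp [k]
  rw [h0, hθ0, mul_one, h1] at e1
  rw [k1, e1] at e2
  rw [hθ0, mul_one] at e3
  exact e3.symm.trans e2

theorem spell_symm (f : Path p p) : W.spell f.symm = (W.spell f)⁻¹ := by
  rw [eq_inv_iff_mul_eq_one, ← spell_trans, ← W.spell_refl]
  exact W.spell_eq_of_homotopic ⟨(Path.Homotopy.reflTransSymm f).symm⟩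

theorem spell_eq_of {f : Path p p} {b : Bool} (h : ∀ t, W.q b (f t) = f t)
    (h' : ∀ t, W.q (!b) (f t) = p) (hf : ¬ f.Homotopic (Path.refl p)) :
    ∃ a : FundamentalGroup X p, a ≠ 1 ∧ W.spell f = letter b a := by
  have hV : ∀ z ∈ Set.univ, W.q (!b) (f.toContinuousMap z) ∈ W.V !b := fun z _ => by
    have : W.q (!b) (f.toContinuousMap z) = p := h' z
    rw [this]; exact W.mem_V _
  have hprim : IsPrimitive (W.cocycle f.toContinuousMap) (W.cocycle f.toContinuousMap 0) :=
    fun z => ⟨Set.univ, Filter.univ_mem, fun u _ v _ => (W.cocycle_mul_of isPathConnected_univ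
      hV (Set.mem_univ _) (Set.mem_univ _) (Set.mem_univ _)).symm⟩
  have e := hprim.apply_one (W.isLocalCocycle _)
  have e0 := W.cocycle_mul_of isPathConnected_univ hV (Set.mem_univ 0) (Set.mem_univ 0) (Set.mem_univ 0)
  have e1 : W.cocycle f.toContinuousMap 0 0 = 1 := by simpa using e0
  rw [e1, mul_one] at e
  refine ⟨pathCocycle (W.γ b) f.toContinuousMap 0 1, fun h => hf
    (homotopic_refl_of_pathCocycle_eq_one h), ?_⟩
  have e2 : (W.q b).comp f.toContinuousMap = f.toContinuousMap := by ext t; exact h t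
  refine e.symm.trans ?_
  rw [W.cocycle_eq_of isPathConnected_univ hV (Set.mem_univ _) (Set.mem_univ _), Bool.not_not, e2]

end CollapsePair

/-! ### Length of reduced words in a free product -/

namespace Monoid.CoprodI

open scoped Classical in
/-- The number of letters of the reduced word of an element of a free product. -/
noncomputable def length {ι : Type*} {M : ι → Type*} [∀ i, Monoid (M i)] (g : CoprodI M) : ℕ :=
  (Word.equiv g).toList.length

variable {ι : Type*} {M : ι → Type*} [∀ i, Monoid (M i)]

theorem length_prod (w : Word M) : length w.prod = w.toList.length := by
  classical
  have : Word.equiv w.prod = w := Word.equiv.right_inv _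
  unfold length
  convert congrArg (fun w : Word M => w.toList.length) this

theorem length_one : length (1 : CoprodI M) = 0 := by
  rw [← Word.prod_empty, length_prod]; rfl

open scoped Classical in
theorem Word.length_rcons_le {i : ι} (P : Word.Pair M i) :
    (Word.rcons P).toList.length ≤ P.tail.toList.length + 1 := by
  unfold Word.rcons
  split_ifs <;> simp [Word.cons]

open scoped Classical in
theorem Word.length_tail_le {i : ι} (P : Word.Pair M i) :
    P.tail.toList.length ≤ (Word.rcons P).toList.length := by
  unfold Word.rcons
  split_ifs <;> simp [Word.cons]

/-- Split off the head of the word in `M i`, possibly `1`: multiplication changes only the head,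
which contributes at most one letter. -/
theorem length_of_mul_le {i : ι} (m : M i) (g : CoprodI M) :
    length (of m * g) ≤ length g + 1 := by
  classical
  obtain ⟨w, rfl⟩ : ∃ w : Word M, w.prod = g := ⟨Word.equiv g, Word.equiv.left_inv g⟩
  obtain ⟨P, rfl⟩ : ∃ P : Word.Pair M i, Word.rcons P = w :=
    ⟨Word.equivPair i w, (Word.equivPair i).symm_apply_apply w⟩
  have h : of m * (Word.rcons P).prod = (Word.rcons { P with head := m * P.head }).prod := by
    rw [Word.prod_rcons, Word.prod_rcons, map_mul, mul_assoc]
  rw [h, length_prod, length_prod]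
  exact (Word.length_rcons_le _).trans (Nat.succ_le_succ (Word.length_tail_le P))

theorem NeWord.length_prod {i j : ι} (w : NeWord M i j) : length w.prod = w.toList.length :=
  CoprodI.length_prod w.toWord

/-- The four-letter commutator word begins in `G j` and ends in `G i`, so its powers concatenate
without cancellation. -/
theorem le_length_pow {G : ι → Type*} [∀ i, Group (G i)] {i j : ι} (hij : i ≠ j) {a : G i} {b : G j}
    (ha : a ≠ 1) (hb : b ≠ 1) (k : ℕ) :
    k ≤ length (((of b)⁻¹ * ((of a)⁻¹ * (of b * of a)) : CoprodI G) ^ k) := by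
  let c : NeWord G j i := (NeWord.singleton b⁻¹ (inv_ne_one.2 hb)).append hij.symm
    ((NeWord.singleton a⁻¹ (inv_ne_one.2 ha)).append hij
      ((NeWord.singleton b hb).append hij.symm (NeWord.singleton a ha)))
  have hc : c.prod = (of b)⁻¹ * ((of a)⁻¹ * (of b * of a)) := by
    simp [c]
  cases k with
  | zero => exact Nat.zero_le _
  | succ k =>
    obtain ⟨w, hw, hl⟩ : ∃ w : NeWord G j i, w.prod = c.prod ^ (k + 1) ∧ k + 1 ≤ w.toList.length := by
      induction k with
      | zero => exact ⟨c, by simp, by simp [c, NeWord.toList]⟩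
      | succ k ih =>
        obtain ⟨w, hw, hl⟩ := ih
        refine ⟨w.append hij c, by rw [NeWord.append_prod, hw, ← pow_succ], ?_⟩
        simp only [NeWord.toList, List.length_append, c, List.length_singleton]
        omega
    rw [← hc, ← hw, NeWord.length_prod]
    exact hl

end Monoid.CoprodI

/-! ### Powers of commutators of loops and the lengths of their words -/

namespace Path

variable {X : Type*} [TopologicalSpace X] {p : X}

/-- The `k`-th power of the commutator of two loops. -/
noncomputable def commPow (x w : Path p p) : ℕ → Path p p
  | 0 => Path.refl p
  | k + 1 => (x.trans (w.trans (x.symm.trans w.symm))).trans (commPow x w k)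

theorem continuous_commPow (x : Path p p) (k : ℕ) : Continuous fun w => commPow x w k := by
  induction k with
  | zero => exact continuous_const
  | succ k ih =>
    refine Continuous.path_trans ?_ ih
    refine Continuous.path_trans continuous_const ?_
    refine Continuous.path_trans continuous_id ?_
    exact Continuous.path_trans continuous_const Path.continuous_symm

theorem commPow_refl_homotopic (x : Path p p) (k : ℕ) :
    (commPow x (Path.refl p) k).Homotopic (Path.refl p) := by
  rw [← Path.Homotopic.Quotient.eq]
  induction k with
  | zero => rfl
  | succ k ih =>
    simp [commPow, Path.Homotopic.Quotient.mk_trans, ih]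

end Path

namespace CollapsePair

variable {X : Type*} [TopologicalSpace X] {p : X} (W : CollapsePair p)

theorem spell_commPow (x w : Path p p) (k : ℕ) : W.spell (x.commPow w k) =
    ((W.spell w)⁻¹ * ((W.spell x)⁻¹ * (W.spell w * W.spell x))) ^ k := by
  induction k with
  | zero => rw [pow_zero]; exact W.spell_refl
  | succ k ih =>
    rw [Path.commPow, spell_trans, ih, pow_succ]
    simp only [spell_trans, spell_symm, mul_assoc]

theorem le_length_spell_commPow {x w : Path p p} (hx : ∀ t, W.q false (x t) = x t)
    (hx' : ∀ t, W.q true (x t) = p) (hx1 : ¬ x.Homotopic (Path.refl p))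
    (hw : ∀ t, W.q true (w t) = w t) (hw' : ∀ t, W.q false (w t) = p)
    (hw1 : ¬ w.Homotopic (Path.refl p)) (k : ℕ) : k ≤ (W.spell (x.commPow w k)).length := by
  obtain ⟨a, ha, ea⟩ := W.spell_eq_of hx hx' hx1
  obtain ⟨b, hb, eb⟩ := W.spell_eq_of hw hw' hw1
  rw [spell_commPow, ea, eb]
  exact Monoid.CoprodI.le_length_pow Bool.false_ne_true ha hb k

/-- Each part of the subdivision, with one collapse confined to its set, contributes at most one
letter. -/
theorem length_spell_le {f : Path p p} {t : ℕ → unitInterval} (ht : Monotone t) (h0 : t 0 = 0)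
    {n : ℕ} (hn : t n = 1)
    (hf : ∀ m < n, ∃ b, ∀ s ∈ Set.Icc (t m) (t (m + 1)), W.q b (f s) ∈ W.V b) :
    (W.spell f).length ≤ n := by
  obtain ⟨θ, hθ, hθ0⟩ := (W.isLocalCocycle f.toContinuousMap).exists_isPrimitive
  have h1 := hθ.apply_one (W.isLocalCocycle _)
  rw [hθ0, mul_one] at h1
  have key : ∀ m ≤ n, (θ (t m)).length ≤ m := by
    intro m
    induction m with
    | zero => intro _; rw [h0, hθ0, Monoid.CoprodI.length_one]
    | succ m ih =>
      intro hm
      obtain ⟨b, hb⟩ := hf m hm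
      have hle := ht (Nat.le_succ m)
      have hK : IsPathConnected (Set.Icc (t m) (t (m + 1))) := by
        have h := (convex_Icc (t m : ℝ) (t (m + 1))).isPathConnected ⟨t m, le_rfl, hle⟩
        exact h.preimage_coe (U := unitInterval) fun s hs =>
          ⟨(t m).2.1.trans hs.1, hs.2.trans (t (m + 1)).2.2⟩
      have hl : t m ∈ Set.Icc (t m) (t (m + 1)) := ⟨le_rfl, hle⟩
      have hr : t (m + 1) ∈ Set.Icc (t m) (t (m + 1)) := ⟨hle, le_rfl⟩
      rw [hθ.eq_mul_of_isPreconnected hK.isConnected.isPreconnected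
        (fun u hu v hv w hw => W.cocycle_mul_of hK hb hu hv hw) hl hr, W.cocycle_eq_of hK hb hl hr]
      exact (Monoid.CoprodI.length_of_mul_le _ _).trans (Nat.succ_le_succ (ih (Nat.le_of_succ_le hm)))
  have := key n le_rfl
  rwa [hn, h1] at this

end CollapsePair

/-! ### Simply connected subsets and essential loops -/

theorem IsSimplyConnected.homotopic {X : Type*} [TopologicalSpace X] {V : Set X}
    (hV : IsSimplyConnected V) {x y : X} (f g : Path x y) (hf : ∀ t, f t ∈ V) (hg : ∀ t, g t ∈ V) :
    f.Homotopic g := by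
  have := hV.simplyConnectedSpace
  have hx : x ∈ V := by simpa using hf 0
  have hy : y ∈ V := by simpa using hf 1
  let f' : Path (⟨x, hx⟩ : V) ⟨y, hy⟩ := ⟨⟨fun t => ⟨f t, hf t⟩, by fun_prop⟩, by simp, by simp⟩
  let g' : Path (⟨x, hx⟩ : V) ⟨y, hy⟩ := ⟨⟨fun t => ⟨g t, hg t⟩, by fun_prop⟩, by simp, by simp⟩
  exact (SimplyConnectedSpace.paths_homotopic f' g').map ⟨Subtype.val, continuous_subtype_val⟩

/-- Take `γ x` inside `V` whenever `x ∈ V`; simple connectedness then identifies all competing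
paths. -/
theorem IsSimplyConnected.exists_isCompatibleOn {X : Type*} [TopologicalSpace X]
    [PathConnectedSpace X] {V : Set X} (hV : IsSimplyConnected V) {p : X} (hp : p ∈ V) :
    ∃ γ : ∀ x : X, Path.Homotopic.Quotient p x, IsCompatibleOn γ V := by
  have h : ∀ x : X, ∃ f : Path p x, x ∈ V → ∀ t, f t ∈ V := by
    intro x
    by_cases hx : x ∈ V
    · obtain ⟨f, hf⟩ := hV.isPathConnected.joinedIn p hp x hx
      exact ⟨f, fun _ => hf⟩
    · exact ⟨PathConnectedSpace.somePath p x, fun h => absurd h hx⟩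
  choose γ hγ using h
  refine ⟨fun x => .mk (γ x), fun x y f hf => ?_⟩
  have hx : x ∈ V := by simpa using hf 0
  have hy : y ∈ V := by simpa using hf 1
  rw [← Path.Homotopic.Quotient.mk_trans, Path.Homotopic.Quotient.eq]
  refine hV.homotopic _ _ (fun t => ?_) (hγ y hy)
  have ht : (γ x).trans f t ∈ Set.range ((γ x).trans f) := ⟨t, rfl⟩
  rw [Path.trans_range] at ht
  rcases ht with ⟨s, hs⟩ | ⟨s, hs⟩
  · exact hs ▸ hγ x hx s
  · exact hs ▸ hf s

theorem exists_loop_not_homotopic_refl {S : Type*} [TopologicalSpace S] [PathConnectedSpace S]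
    (hS : ¬ SimplyConnectedSpace S) (p : S) : ∃ f : Path p p, ¬ f.Homotopic (Path.refl p) := by
  by_contra! hcon
  refine hS (simply_connected_iff_loops_nullhomotopic.2 ⟨inferInstance, fun x f => ?_⟩)
  have hsub : Subsingleton (FundamentalGroup S p) := by
    refine subsingleton_of_forall_eq 1 fun a => ?_
    obtain ⟨f, rfl⟩ := Path.Homotopic.Quotient.mk_surjective a
    exact Path.Homotopic.Quotient.eq.2 (hcon f)
  have hsub' : Subsingleton (FundamentalGroup S x) :=
    (FundamentalGroup.fundamentalGroupMulEquivOfPathConnected x p).toEquiv.subsingleton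
  have : (Path.Homotopic.Quotient.mk f : FundamentalGroup S x) = Path.Homotopic.Quotient.refl x :=
    Subsingleton.elim (α := FundamentalGroup S x) _ _
  exact Path.Homotopic.Quotient.exact this

/-! ### Geometry of the pieces and their collapsing maps -/

namespace IsHawaiianDecomposition

variable {X : Type*} [MetricSpace X] {p : X} {Y : ℕ → Set X}

theorem base_mem (h : IsHawaiianDecomposition p Y) (n : ℕ) : p ∈ Y n := by
  have : p ∈ Y n ∩ Y (n + 1) := by rw [h.inter_eq n (n + 1) (by omega)]; rfl
  exact this.1

theorem eq_base (h : IsHawaiianDecomposition p Y)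
    {n m : ℕ} (hnm : n ≠ m) {x : X} (hn : x ∈ Y n) (hm : x ∈ Y m) : x = p := by
  have : x ∈ Y n ∩ Y m := ⟨hn, hm⟩
  rwa [h.inter_eq n m hnm] at this

theorem eventually_subset (h : IsHawaiianDecomposition p Y)
    {U : Set X} (hU : U ∈ 𝓝 p) : ∀ᶠ n in Filter.atTop, Y n ⊆ U := by
  obtain ⟨ε, hε, hεU⟩ := Metric.mem_nhds_iff.1 hU
  have := h.tendsto_diam.eventually (gt_mem_nhds (ENNReal.ofReal_pos.2 hε))
  filter_upwards [this] with n hn x hx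
  refine hεU ?_
  rw [Metric.mem_ball, ← edist_lt_ofReal]
  exact (Metric.edist_le_ediam_of_mem hx (h.base_mem n)).trans_lt hn

/-- All but finitely many pieces lie in a neighbourhood of `p` that misses a neighbourhood of `x`;
the finitely many others are closed and, apart from `Y m`, miss `x`. -/
theorem mem_nhds (h : IsHawaiianDecomposition p Y)
    {x : X} (hx : x ≠ p) {m : ℕ} (hm : x ∈ Y m) : Y m ∈ 𝓝 x := by
  obtain ⟨U, U', hU, hU', hxU, hpU', hd⟩ := t2_separation hx
  obtain ⟨N, hN⟩ := Filter.eventually_atTop.1 (h.eventually_subset (hU'.mem_nhds hpU'))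
  have h1 : ∀ᶠ y in 𝓝 x, ∀ n ∈ Finset.range N, n ≠ m → y ∉ Y n := by
    rw [Filter.eventually_all_finset]
    intro n _
    by_cases hnm : n = m
    · exact Filter.Eventually.of_forall fun y hy => absurd hnm hy
    · filter_upwards [(h.isClosed n).isOpen_compl.mem_nhds fun hn => hx (h.eq_base hnm hn hm)]
        with y hy _ using hy
  filter_upwards [h1, hU.mem_nhds hxU] with y hy hyU
  obtain ⟨n, hn⟩ := Set.mem_iUnion.1 (h.iUnion_eq ▸ Set.mem_univ y)
  by_cases hnm : n = m
  · exact hnm ▸ hn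
  by_cases hnN : n < N
  · exact absurd hn (hy n (Finset.mem_range.2 hnN) hnm)
  · exact absurd (hN n (not_lt.1 hnN) hn) (Set.disjoint_left.1 hd hyU)

theorem pathConnectedSpace (h : IsHawaiianDecomposition p Y) : PathConnectedSpace X := by
  refine pathConnectedSpace_iff_univ.2 ⟨p, trivial, fun {x} _ => ?_⟩
  obtain ⟨n, hn⟩ := Set.mem_iUnion.1 (h.iUnion_eq ▸ Set.mem_univ x)
  exact ((h.isPathConnected n).joinedIn p (h.base_mem n) x hn).mono (Set.subset_univ _)

open scoped Classical in
/-- The retraction onto a piece that collapses the other pieces to the distinguished point. -/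
noncomputable def collapse (h : IsHawaiianDecomposition p Y) (n : ℕ) : C(X, X) where
  toFun x := if x ∈ Y n then x else p
  continuous_toFun := by
    rw [continuous_iff_continuousAt]
    intro x
    by_cases hx : x ∈ Y n
    · by_cases hxp : x = p
      · subst hxp
        have hx0 : (if x ∈ Y n then x else x) = x := by simp
        intro U hU
        simp only [hx0] at hU
        rw [Filter.mem_map]
        filter_upwards [hU] with y hy
        by_cases hyn : y ∈ Y n
        · simpa [hyn] using hy
        · simpa [hyn] using mem_of_mem_nhds hU
      · refine continuousAt_id.congr ?_
        filter_upwards [h.mem_nhds hxp hx] with y hy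
        simp [hy]
    · refine (continuousAt_const (y := p)).congr ?_
      filter_upwards [(h.isClosed n).isOpen_compl.mem_nhds hx] with y hy
      exact (if_neg hy).symm

theorem collapse_of_mem (h : IsHawaiianDecomposition p Y)
    {n : ℕ} {x : X} (hx : x ∈ Y n) : h.collapse n x = x := if_pos hx

theorem collapse_of_notMem (h : IsHawaiianDecomposition p Y)
    {n : ℕ} {x : X} (hx : x ∉ Y n) : h.collapse n x = p := if_neg hx

theorem collapse_of_mem_of_ne (h : IsHawaiianDecomposition p Y)
    {n m : ℕ} (hnm : n ≠ m) {x : X} (hx : x ∈ Y m) :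
    h.collapse n x = p := by
  by_cases hn : x ∈ Y n
  · rw [h.collapse_of_mem hn, h.eq_base hnm hn hx]
  · exact h.collapse_of_notMem hn

theorem collapse_mem (h : IsHawaiianDecomposition p Y) (n : ℕ) (x : X) : h.collapse n x ∈ Y n := by
  by_cases hn : x ∈ Y n
  · rwa [h.collapse_of_mem hn]
  · rw [h.collapse_of_notMem hn]; exact h.base_mem n

theorem exists_isCompatibleOn (h : IsHawaiianDecomposition p Y)
    (n : ℕ) : ∃ (V : Set X) (γ : ∀ x : X, Path.Homotopic.Quotient p x),
    p ∈ V ∧ h.collapse n ⁻¹' V ∈ 𝓝 p ∧ IsCompatibleOn γ V := by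
  have := h.pathConnectedSpace
  obtain ⟨V, hV, -, hVs⟩ :=
    h.locallySimplyConnectedAt n (h.base_mem n) Set.univ Filter.univ_mem
  have hpV : p ∈ Subtype.val '' V := ⟨⟨p, h.base_mem n⟩, mem_of_mem_nhds hV, rfl⟩
  obtain ⟨γ, hγ⟩ := (IsEmbedding.subtypeVal.isSimplyConnected_image.2 hVs).exists_isCompatibleOn hpV
  refine ⟨Subtype.val '' V, γ, hpV, ?_, hγ⟩
  obtain ⟨u, hu, huV⟩ := (mem_nhds_subtype _ _ _).1 hV
  filter_upwards [hu] with x hx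
  by_cases hn : x ∈ Y n
  · rw [Set.mem_preimage, h.collapse_of_mem hn]
    exact ⟨⟨x, hn⟩, huV hx, rfl⟩
  · rwa [Set.mem_preimage, h.collapse_of_notMem hn]

/-- An essential loop of `Y n` stays essential in `X` because the collapse retracts `X` onto `Y n`.
-/
theorem exists_loop (h : IsHawaiianDecomposition p Y) (n : ℕ) :
    ∃ f : Path p p, (∀ t, f t ∈ Y n) ∧ ¬ f.Homotopic (Path.refl p) := by
  have := isPathConnected_iff_pathConnectedSpace.1 (h.isPathConnected n)
  obtain ⟨f, hf⟩ := exists_loop_not_homotopic_refl (h.not_isSimplyConnected n) ⟨p, h.base_mem n⟩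
  refine ⟨f.map continuous_subtype_val, fun t => (f t).2, fun hcon => hf ?_⟩
  let r : C(X, Y n) := ⟨fun x => ⟨h.collapse n x, h.collapse_mem n x⟩, by fun_prop⟩
  have hr : ∀ y : Y n, r y = y := fun y => Subtype.ext (h.collapse_of_mem y.2)
  have h1 := (hcon.map r).pathCast (hr ⟨p, h.base_mem n⟩).symm (hr ⟨p, h.base_mem n⟩).symm
  convert! h1 using 1
  · ext t; exact (congrArg Subtype.val (hr (f t))).symm
  · ext t; exact (congrArg Subtype.val (hr ⟨p, h.base_mem n⟩)).symm

/-- The collapsing maps to the pieces `0` and `n`, with a choice of small sets. -/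
noncomputable def collapsePair (h : IsHawaiianDecomposition p Y)
    {n : ℕ} (hn : n ≠ 0) : CollapsePair p where
  q b := h.collapse (bif b then n else 0)
  q_base b := h.collapse_of_mem (h.base_mem _)
  V b := (h.exists_isCompatibleOn (bif b then n else 0)).choose
  mem_V b := (h.exists_isCompatibleOn (bif b then n else 0)).choose_spec.choose_spec.1
  γ b := (h.exists_isCompatibleOn (bif b then n else 0)).choose_spec.choose
  compatible b := (h.exists_isCompatibleOn (bif b then n else 0)).choose_spec.choose_spec.2.2
  cover x := by
    by_cases hx : x = p
    · subst hx
      exact ⟨false, (h.exists_isCompatibleOn 0).choose_spec.choose_spec.2.1⟩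
    obtain ⟨m, hm⟩ := Set.mem_iUnion.1 (h.iUnion_eq ▸ Set.mem_univ x)
    -- Away from `p`, a point lies in the interior of a single piece, so a collapse onto any other
    -- piece is constantly `p` nearby. Hence small simply connected sets are needed only at `p`.
    have key : ∀ b : Bool, (bif b then n else 0) ≠ m →
        h.collapse (bif b then n else 0) ⁻¹'
          (h.exists_isCompatibleOn (bif b then n else 0)).choose ∈ 𝓝 x := by
      intro b hb
      filter_upwards [h.mem_nhds hx hm] with y hy
      rw [Set.mem_preimage, h.collapse_of_mem_of_ne hb hy]
      exact (h.exists_isCompatibleOn (bif b then n else 0)).choose_spec.choose_spec.1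
    by_cases hm0 : m = 0
    · exact ⟨true, key true (by rw [hm0]; exact hn)⟩
    · exact ⟨false, key false (Ne.symm hm0)⟩

/-- Near each loop, the words spelled by loops are of bounded length. -/
theorem exists_eventually_length_spell_le (h : IsHawaiianDecomposition p Y) (f : Path p p) :
    ∃ M, ∀ᶠ g in 𝓝 f, ∀ (n : ℕ) (hn : n ≠ 0), ((h.collapsePair hn).spell g).length ≤ M := by
  let V₀ := (h.exists_isCompatibleOn 0).choose
  have hV₀ : h.collapse 0 ⁻¹' V₀ ∈ 𝓝 p := (h.exists_isCompatibleOn 0).choose_spec.choose_spec.2.1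
  -- Here `true` marks the region near `p` and `false` the complement of `p`. The cover involves
  -- only piece `0`, which makes the bound independent of `n`.
  let O : Bool → Set X := fun b => bif b then interior (h.collapse 0 ⁻¹' V₀) else {p}ᶜ
  have hO : ∀ b, IsOpen (O b) := by
    rintro (_ | _)
    exacts [isOpen_compl_singleton, isOpen_interior]
  obtain ⟨t, ht0, htm, ⟨N, hN⟩, htc⟩ := exists_monotone_Icc_subset_open_cover_unitInterval
    (c := fun b => f ⁻¹' O b) (fun b => (hO b).preimage f.continuous) (fun s _ => by
      rw [Set.mem_iUnion]
      by_cases hs : f s = p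
      · refine ⟨true, ?_⟩
        rw [Set.mem_preimage, hs]
        exact mem_interior_iff_mem_nhds.2 hV₀
      · exact ⟨false, hs⟩)
  choose b hb using htc
  refine ⟨N, ?_⟩
  have hev : ∀ᶠ g : Path p p in 𝓝 f, ∀ m ∈ Finset.range N,
      Set.MapsTo g (Set.Icc (t m) (t (m + 1))) (O (b m)) := by
    rw [Filter.eventually_all_finset]
    intro m _
    have hc : Continuous fun g : Path p p => g.toContinuousMap := continuous_induced_dom
    exact hc.continuousAt.eventually (ContinuousMap.eventually_mapsTo isCompact_Icc (hO (b m)) (hb m))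
  filter_upwards [hev] with g hg n hn
  refine (h.collapsePair hn).length_spell_le htm ht0 (hN N le_rfl) fun m hm => ?_
  have hgm := hg m (Finset.mem_range.2 hm)
  cases hbm : b m with
  | true =>
    rw [hbm] at hgm
    have hsub : O true ⊆ h.collapse 0 ⁻¹' V₀ := interior_subset
    exact ⟨false, fun s hs => hsub (hgm hs)⟩
  | false =>
    rw [hbm] at hgm
    -- On a part where `g` avoids `p`, membership in `Y 0` is locally constant, hence constant:
    -- inside `Y 0` the collapse onto `Y n` is constantly `p`, outside it the collapse onto `Y 0`
    -- is.
    have hconst := fun x y hx hy => isPreconnected_Icc.eq_of_locally_eq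
      (K := Set.Icc (t m) (t (m + 1))) (η := fun s => g s ∈ Y 0) (fun s hs => by
        by_cases hs0 : g s ∈ Y 0
        · exact ⟨_, g.continuous.continuousAt (h.mem_nhds (hgm hs) hs0), fun y hy =>
            propext ⟨fun _ => hs0, fun _ => hy.1⟩⟩
        · exact ⟨_, g.continuous.continuousAt ((h.isClosed 0).isOpen_compl.mem_nhds hs0),
            fun y hy => propext ⟨fun hy0 => absurd hy0 hy.1, fun h0 => absurd h0 hs0⟩⟩)
        (x := x) (y := y) hx hy
    by_cases h0 : ∃ s ∈ Set.Icc (t m) (t (m + 1)), g s ∈ Y 0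
    · obtain ⟨s, hs, hs0⟩ := h0
      refine ⟨true, fun u hu => ?_⟩
      have hu0 : g u ∈ Y 0 := (hconst s u hs hu).mp hs0
      have : (h.collapsePair hn).q true (g u) = p := h.collapse_of_mem_of_ne hn hu0
      rw [this]
      exact (h.collapsePair hn).mem_V true
    · push Not at h0
      refine ⟨false, fun u hu => ?_⟩
      have : (h.collapsePair hn).q false (g u) = p := h.collapse_of_notMem (h0 u hu)
      rw [this]
      exact (h.collapsePair hn).mem_V false

theorem le_length_spell_commPow (h : IsHawaiianDecomposition p Y)
    {x w : Path p p} (hx : ∀ t, x t ∈ Y 0)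
    (hx1 : ¬ x.Homotopic (Path.refl p)) {n : ℕ} (hn : n ≠ 0) (hw : ∀ t, w t ∈ Y n)
    (hw1 : ¬ w.Homotopic (Path.refl p)) (k : ℕ) :
    k ≤ ((h.collapsePair hn).spell (x.commPow w k)).length :=
  (h.collapsePair hn).le_length_spell_commPow (fun t => h.collapse_of_mem (hx t))
    (fun t => h.collapse_of_mem_of_ne hn (hx t)) hx1 (fun t => h.collapse_of_mem (hw t))
    (fun t => h.collapse_of_mem_of_ne hn.symm (hw t)) hw1 k

end IsHawaiianDecomposition

/-! ### Topological fundamental groups under retraction and change of base point -/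

namespace Path

variable {X : Type*} [TopologicalSpace X] {x y : X}

/-- The exponential law for the compact-open topology: a path of paths is a homotopy. -/
theorem joined_iff_homotopic {f g : Path x y} : Joined f g ↔ f.Homotopic g := by
  constructor
  · rintro ⟨Φ⟩
    have hc : Continuous fun st : unitInterval × unitInterval => Φ st.1 st.2 :=
      continuous_uncurry_iff.2 Φ.continuous
    exact ⟨{ toFun := fun st => Φ st.1 st.2
             continuous_toFun := hc
             map_zero_left := by simp
             map_one_left := by simp
             prop' := by rintro s t (rfl | rfl) <;> simp }⟩
  · rintro ⟨H⟩
    exact ⟨{ toFun := H.eval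
             continuous_toFun := continuous_uncurry_iff.1 H.continuous
             source' := H.eval_zero
             target' := H.eval_one }⟩

theorem continuous_map_cast {Y : Type*} [TopologicalSpace Y] {F : X → Y} (hF : Continuous F)
    {x' y' : Y} (hx : x' = F x) (hy : y' = F y) :
    Continuous fun f : Path x y => (f.map hF).cast hx hy := by
  refine continuous_uncurry_iff.1 ?_
  change Continuous fun ft : Path x y × unitInterval => F (ft.1 ft.2)
  fun_prop

end Path

namespace TopFundamentalGroup

variable {X Y : Type*} [TopologicalSpace X] [TopologicalSpace Y] {p : X} {y₀ : Y}

/-- The class of a loop. -/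
def mk (f : Path p p) : TopFundamentalGroup X p := ZerothHomotopy.mk f

theorem isQuotientMap_mk : IsQuotientMap (mk : Path p p → TopFundamentalGroup X p) :=
  ZerothHomotopy.isQuotientMap_mk

theorem mk_eq_mk {f g : Path p p} : mk f = mk g ↔ f.Homotopic g :=
  Quotient.eq.trans Path.joined_iff_homotopic

/-- The map of fundamental groups induced by a map of loops. -/
def map (A : Path p p → Path y₀ y₀) (hA : ∀ f g, f.Homotopic g → (A f).Homotopic (A g)) :
    TopFundamentalGroup X p → TopFundamentalGroup Y y₀ :=
  Quotient.lift (fun f => mk (A f)) fun _ _ h =>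
    mk_eq_mk.2 (hA _ _ (Path.joined_iff_homotopic.1 h))

theorem continuous_map {A : Path p p → Path y₀ y₀} (hc : Continuous A)
    (hA : ∀ f g, f.Homotopic g → (A f).Homotopic (A g)) : Continuous (map A hA) :=
  isQuotientMap_mk.continuous_iff.2 (isQuotientMap_mk.continuous.comp hc)

/-- A retract up to homotopy of a loop space inherits metrizability of the fundamental group. -/
theorem metrizableSpace_of_retract [TopologicalSpace.MetrizableSpace (TopFundamentalGroup Y y₀)]
    {A : Path p p → Path y₀ y₀} {B : Path y₀ y₀ → Path p p} (hAc : Continuous A) (hBc : Continuous B)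
    (hA : ∀ f g, f.Homotopic g → (A f).Homotopic (A g))
    (hB : ∀ f g, f.Homotopic g → (B f).Homotopic (B g)) (h : ∀ f, (B (A f)).Homotopic f) :
    TopologicalSpace.MetrizableSpace (TopFundamentalGroup X p) := by
  have hinv : Function.LeftInverse (map B hB) (map A hA) := fun a => by
    obtain ⟨f, rfl⟩ := isQuotientMap_mk.surjective a
    exact mk_eq_mk.2 (h f)
  exact (hinv.isEmbedding (continuous_map hBc hB) (continuous_map hAc hA)).metrizableSpace

theorem metrizableSpace_of_joined {y₁ : Y}
    [TopologicalSpace.MetrizableSpace (TopFundamentalGroup Y y₀)] (h : Joined y₀ y₁) :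
    TopologicalSpace.MetrizableSpace (TopFundamentalGroup Y y₁) := by
  obtain ⟨δ⟩ := h
  refine metrizableSpace_of_retract (y₀ := y₀) (A := fun f => δ.trans (f.trans δ.symm))
    (B := fun f => δ.symm.trans (f.trans δ))
    (continuous_const.path_trans (continuous_id.path_trans continuous_const))
    (continuous_const.path_trans (continuous_id.path_trans continuous_const))
    (fun f g hfg => .hcomp (.refl _) (.hcomp hfg (.refl _)))
    (fun f g hfg => .hcomp (.refl _) (.hcomp hfg (.refl _))) (fun f => ?_)
  rw [← Path.Homotopic.Quotient.eq]
  simp [Path.Homotopic.Quotient.mk_trans, Path.Homotopic.Quotient.trans_assoc,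
    Path.Homotopic.Quotient.trans_symm_trans]

theorem metrizableSpace_of_leftInverse {e : X → Y} {ρ : Y → X} (he : Continuous e)
    (hρ : Continuous ρ) (h : Function.LeftInverse ρ e)
    [TopologicalSpace.MetrizableSpace (TopFundamentalGroup Y (e p))] :
    TopologicalSpace.MetrizableSpace (TopFundamentalGroup X p) := by
  refine metrizableSpace_of_retract (y₀ := e p) (A := fun f => (f.map he).cast rfl rfl)
    (B := fun f => (f.map hρ).cast (h p).symm (h p).symm)
    (Path.continuous_map_cast _ _ _) (Path.continuous_map_cast _ _ _)
    (fun f g hfg => (hfg.map ⟨e, he⟩).pathCast _ _)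
    (fun f g hfg => (hfg.map ⟨ρ, hρ⟩).pathCast _ _) (fun f => ?_)
  convert! Path.Homotopic.refl f using 1
  ext t
  exact h (f t)

end TopFundamentalGroup

/-! ### Failure of metrizability -/

/-- The topological fundamental group of a space similar to the Hawaiian earring is not
metrizable. -/
theorem IsHawaiianDecomposition.not_metrizableSpace {X : Type*} [MetricSpace X] {p : X}
    {Y : ℕ → Set X} (h : IsHawaiianDecomposition p Y) :
    ¬ TopologicalSpace.MetrizableSpace (TopFundamentalGroup X p) := by
  intro hmet
  choose x hxY hx using h.exists_loop
  have hlim : Filter.Tendsto x Filter.atTop (𝓝 (Path.refl p)) := by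
    rw [nhds_induced, Filter.tendsto_comap_iff, ContinuousMap.tendsto_nhds_compactOpen]
    intro K _ U hU hKU
    rcases K.eq_empty_or_nonempty with rfl | ⟨s, hs⟩
    · exact Filter.Eventually.of_forall fun _ => Set.mapsTo_empty _ _
    · have hpU : p ∈ U := hKU hs
      filter_upwards [h.eventually_subset (hU.mem_nhds hpU)] with n hn s _ using hn (hxY n s)
  have hpow : ∀ k, Filter.Tendsto (fun n => TopFundamentalGroup.mk ((x 0).commPow (x n) k))
      Filter.atTop (𝓝 (TopFundamentalGroup.mk (Path.refl p))) := by
    intro k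
    rw [← TopFundamentalGroup.mk_eq_mk.2 (Path.commPow_refl_homotopic (x 0) k)]
    exact (TopFundamentalGroup.isQuotientMap_mk.continuous.comp
      (Path.continuous_commPow (x 0) k)).continuousAt.tendsto.comp hlim
  obtain ⟨U, hU⟩ := (𝓝 (TopFundamentalGroup.mk (Path.refl p))).exists_antitone_basis
  -- The exponent `k + 1` gives even `c 0` positive length, so none of the `c k` is trivial.
  have hex : ∀ k, ∃ n ≠ 0, TopFundamentalGroup.mk ((x 0).commPow (x n) (k + 1)) ∈ U k := fun k =>
    (((Filter.eventually_ne_atTop 0).and ((hpow (k + 1)).eventually (hU.mem k))).exists)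
  choose n hn hnU using hex
  let c : ℕ → Path p p := fun k => (x 0).commPow (x (n k)) (k + 1)
  have hc : Filter.Tendsto (fun k => TopFundamentalGroup.mk (c k)) Filter.atTop
      (𝓝 (TopFundamentalGroup.mk (Path.refl p))) :=
    hU.tendsto hnU
  have hlen : ∀ k f, TopFundamentalGroup.mk f = TopFundamentalGroup.mk (c k) →
      k + 1 ≤ ((h.collapsePair (hn k)).spell f).length := by
    intro k f hf
    rw [(h.collapsePair (hn k)).spell_eq_of_homotopic (TopFundamentalGroup.mk_eq_mk.1 hf)]
    exact h.le_length_spell_commPow (hxY 0) (hx 0) (hn k) (hxY _) (hx _) (k + 1)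
  -- Where lengths are at most `M`, only the classes with `k + 1 ≤ M` can occur.
  have hfin : LocallyFinite fun k =>
      (TopFundamentalGroup.mk ⁻¹' {TopFundamentalGroup.mk (c k)} : Set (Path p p)) := by
    intro f
    obtain ⟨M, hM⟩ := h.exists_eventually_length_spell_le f
    refine ⟨_, hM, (Set.finite_lt_nat M).subset ?_⟩
    rintro k ⟨g, hg, hgM⟩
    exact (hlen k g hg).trans (hgM _ (hn k))
  -- Closedness is checked on loops: the preimage is a locally finite union of preimages of points,
  -- which are closed by the assumed metrizability.
  have hclosed : IsClosed (Set.range fun k => TopFundamentalGroup.mk (c k)) := by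
    rw [← TopFundamentalGroup.isQuotientMap_mk.isClosed_preimage]
    convert! hfin.isClosed_iUnion fun k => isClosed_singleton.preimage
      TopFundamentalGroup.isQuotientMap_mk.continuous
      using 1
    ext f
    simp [eq_comm]
  obtain ⟨k, hk⟩ := hclosed.mem_of_tendsto hc (Filter.Eventually.of_forall fun k => ⟨k, rfl⟩)
  have := hlen k (Path.refl p) hk.symm
  rw [CollapsePair.spell_refl, Monoid.CoprodI.length_one] at this
  omega

theorem theorem3 {X : Type*} [MetricSpace X] (p : X) (hX : IsSimilarToHawaiianEarring X p)
    {Y : Type*} [TopologicalSpace Y] [TopologicalSpace.MetrizableSpace Y] (y₀ : Y)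
    (hY : TopologicalSpace.IsCompletelyMetrizableSpace (TopFundamentalGroup Y y₀)) :
    ¬ ∃ e : X → Y, IsEmbedding e ∧ Joined y₀ (e p) ∧ IsRetract (Set.range e) := by
  rintro ⟨e, he, hj, r, hr⟩
  obtain ⟨Z, hZ⟩ := hX
  have := TopFundamentalGroup.metrizableSpace_of_joined hj
  refine hZ.not_metrizableSpace (TopFundamentalGroup.metrizableSpace_of_leftInverse
    (ρ := he.toHomeomorph.symm ∘ r) he.continuous
    (he.toHomeomorph.symm.continuous.comp r.continuous) fun x => ?_)
  have : r (e x) = he.toHomeomorph x := hr ⟨e x, x, rfl⟩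
  simp [this]
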